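/- **Conventions.** Infinite matrices are real with rows and columns indexed by $0,1,2,\dots$; all products below involve only finite sums entrywise. $[A]_n$ is the matrix of the first $n$ rows and columns of $A$. $A$ is *positive definite of infinite order* if $\det[A]_n>0$ for all $n\ge1$, and *positive definite of order $m$* ($m\ge 0$ an integer) if $\det[A]_n>0$ for $1\le n\le m$ and $\det[A]_n=0$ for all $n>m$. $U$ is the shift matrix with entries $\delta_{i+1,j}$, $U^{-1}:=U^{\mathsf T}$, $D_k=\operatorname{diag}\big(\tfrac{(k+i)!}{i!}\big)_{i\ge0}$, and a Hankel matrix is a matrix with $h_{i,j+1}=h_{i+1,j}$. A matrix $M$ is *Hankel–Sobolev of index $d$* ($d\ge 0$ an integer) if $M=\sum_{k\ge0}U^{-k}D_kH_kD_kU^k$ with Hankel matrices $H_k$ such that $H_d\ne0$ and $H_k=0$ for $k>d$. Put $\Phi(A,\eta)=\sum_{\ell=0}^{\eta}(-1)^\ell\binom{\eta}{\ell}U^{\eta-\ell}AU^{-\ell}$. Let $G=(g_{i,j})$ be a non-degenerate Hessenberg matrix: $g_{i,j}=0$ for $j>i+1$ and $g_{i,i+1}\neq0$ for all $i$. Fix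 $t_0>0$; the polynomials generated by $G$ are given by $Q_0=t_0$ and $g_{n,n+1}Q_{n+1}=xQ_n-\sum_{k=0}^n g_{n,k}Q_k$. Let $T$ be the lower triangular matrix of their coefficients, $Q_i=\sum_j t_{i,j}x^j$, let $M_G=(m_{i,j})=T^{-1}T^{-\mathsf T}$ be the matrix of formal moments, and for real polynomials $p=\sum a_ix^i$, $q=\sum b_jx^j$ let $\langle p,q\rangle_G=\sum_{i,j}a_im_{i,j}b_j$. $G$ is *Hessenberg–Sobolev of index $d$* if $M_G$ is Hankel–Sobolev of index $d$. For $d\ge0$ define $M_d=M_G$ and, successively for $k=0,\dots,d$, $$H_{d-k}=\frac{(-1)^{d-k}}{(2d-2k)!}\,\Phi(M_{d-k},2d-2k),\qquad M_{d-k-1}=M_{d-k}-U^{-(d-k)}D_{d-k}H_{d-k}D_{d-k}U^{d-k}\quad(k<d).$$ A *discrete-continuous vector of measures of length $d+1$* is $\vec\mu=(\mu_0,\dots,\mu_d)$, where each $\mu_k$ is a finite non-negative Borel measure on $\mathbb R$ for which all polynomials are integrable, the support of $\mu_d$ is infinite, and the supports of $\mu_0,\dots,\mu_{d-1}$ are finite.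 Put $\langle p,q\rangle_{\vec\mu}=\sum_{k=0}^d\int p^{(k)}q^{(k)}\,d\mu_k$. **Theorem (Favard type theorem, discrete-continuous case).** There exist an integer $d\ge0$ and a discrete-continuous vector $\vec\mu$ of length $d+1$ with $\langle p,q\rangle_{\vec\mu}=\langle p,q\rangle_G$ for all real polynomials $p,q$ if and only if there is an integer $d\ge0$ such that 1. $G$ is a Hessenberg–Sobolev matrix of index $d$; 2. $H_d$ is positive definite of infinite order and, for each $k=1,\dots,d$, the matrix $H_{d-k}$ is positive definite of some finite order $m_k\ge0$. Moreover the same $d$ serves on both sides: for each integer $d\ge0$, such a vector $\vec\mu$ of length $d+1$ exists if and only if 1 and 2 hold for this $d$. Finally, for every discrete-continuous vector $\vec\mu$, the identity $\langle p,q\rangle_{\vec\mu}=\langle p,q\rangle_G$ holds for all $p,q$ if and only if the generated polynomials are orthonormal, that is, $\langle Q_m,Q_n\rangle_{\vec\mu}=\delta_{m,n}$ for all $m,n\ge0$. -/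

import Mathlib

open MeasureTheory Polynomial

namespace HessenbergSobolev

noncomputable section

/-- Infinite matrices of real numbers, with rows and columns indexed by `0, 1, 2, …`.
Transposition, addition, subtraction and scalar multiplication are those of Mathlib. -/
abbrev InfMatrix : Type := Matrix ℕ ℕ ℝ

/-- Product of infinite matrices. It is only applied where, for all `i` and `j`, finitely many
summands are nonzero. -/
def matMul (A B : InfMatrix) : InfMatrix := fun i j => ∑ᶠ k, A i k * B k j

/-- Powers of an infinite matrix. -/
def matPow (A : InfMatrix) : ℕ → InfMatrix
  | 0 => 1
  | n + 1 => matMul A (matPow A n)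

/-- `[A]_n`, the matrix of the first `n` rows and columns. -/
def leading (A : InfMatrix) (n : ℕ) : Matrix (Fin n) (Fin n) ℝ :=
  fun i j => A i j

/-- Positive definite of infinite order. -/
def PosDefInfinite (A : InfMatrix) : Prop :=
  ∀ n : ℕ, 1 ≤ n → 0 < (leading A n).det

/-- Positive definite of order `m`, for a nonnegative integer `m`. -/
def PosDefOfOrder (A : InfMatrix) (m : ℕ) : Prop :=
  (∀ n : ℕ, 1 ≤ n → n ≤ m → 0 < (leading A n).det) ∧
    ∀ n : ℕ, m < n → (leading A n).det = 0

/-- The upper shift matrix `U`. Its right inverse `U⁻¹` is the transpose `Uᵀ`. -/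
def shift : InfMatrix := fun i j => if i + 1 = j then 1 else 0

/-- Hankel matrices. -/
def IsHankel (H : InfMatrix) : Prop := ∀ i j : ℕ, H i (j + 1) = H (i + 1) j

/-- The diagonal matrix `D_k` with entries `(k + i)! / i!`. -/
def diagD (k : ℕ) : InfMatrix :=
  Matrix.diagonal fun i => ((k + i).factorial : ℝ) / (i.factorial : ℝ)

/-- The matrix `U⁻ᵏ D_k H D_k Uᵏ`. -/
def block (k : ℕ) (H : InfMatrix) : InfMatrix :=
  matMul (matPow shift.transpose k) (matMul (diagD k) (matMul H (matMul (diagD k) (matPow shift k))))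

/-- `M` is a Hankel–Sobolev matrix of finite index `d`: `M = ∑ₖ U⁻ᵏ D_k H_k D_k Uᵏ` with Hankel
matrices `H_k` such that `H_d ≠ 0` and `H_k = 0` for `k > d`. (Each entry of the series has only
finitely many nonzero terms.) -/
def IsHankelSobolevOfIndex (M : InfMatrix) (d : ℕ) : Prop :=
  ∃ H : ℕ → InfMatrix, (∀ k, IsHankel (H k)) ∧
    (∀ i j, M i j = ∑ᶠ k, block k (H k) i j) ∧
    H d ≠ 0 ∧ ∀ k, d < k → H k = 0

/-- `Φ(A, η) = ∑_{ℓ=0}^{η} (-1)^ℓ (η choose ℓ) U^{η-ℓ} A U^{-ℓ}`. -/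
def Phi (A : InfMatrix) (η : ℕ) : InfMatrix :=
  ∑ l ∈ Finset.range (η + 1),
    ((-1 : ℝ) ^ l * (η.choose l : ℝ)) •
      matMul (matPow shift (η - l)) (matMul A (matPow shift.transpose l))

/-- `(-1)^k / (2k)! · Φ(A, 2k)`. -/
def topHankel (A : InfMatrix) (k : ℕ) : InfMatrix :=
  ((-1 : ℝ) ^ k / ((2 * k).factorial : ℝ)) • Phi A (2 * k)

/-- `partialMatrix M d k` is the matrix `M_{d-k}`: one has `M_d = M`, and
`M_{d-k-1} = M_{d-k} - U^{-(d-k)} D_{d-k} H_{d-k} D_{d-k} U^{d-k}` with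
`H_{d-k} = (-1)^{d-k} / (2(d-k))! · Φ(M_{d-k}, 2(d-k))`. Used for `k ≤ d` only. -/
def partialMatrix (M : InfMatrix) (d : ℕ) : ℕ → InfMatrix
  | 0 => M
  | k + 1 => partialMatrix M d k - block (d - k) (topHankel (partialMatrix M d k) (d - k))

/-- `hankelComponent M d k` is the matrix
`H_{d-k} = (-1)^{d-k} / (2(d-k))! · Φ(M_{d-k}, 2(d-k))`. Used for `k ≤ d` only. -/
def hankelComponent (M : InfMatrix) (d k : ℕ) : InfMatrix :=
  topHankel (partialMatrix M d k) (d - k)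

/-- Non-degenerate lower Hessenberg infinite matrices. -/
def IsNondegenerateHessenberg (G : InfMatrix) : Prop :=
  (∀ i j : ℕ, i + 1 < j → G i j = 0) ∧ ∀ i : ℕ, G i (i + 1) ≠ 0

/-- The polynomials generated by `G`, with `Q_0 = t₀` and
`g_{n,n+1} Q_{n+1} = x Q_n - ∑_{k=0}^{n} g_{n,k} Q_k`. -/
def genPoly (G : InfMatrix) (t₀ : ℝ) : ℕ → ℝ[X]
  | 0 => C t₀
  | n + 1 => C (G n (n + 1))⁻¹ *
      (X * genPoly G t₀ n - ∑ k : Fin (n + 1), C (G n k) * genPoly G t₀ k)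

/-- The lower triangular matrix `T` of the coefficients of the generated polynomials. -/
def coeffMatrix (G : InfMatrix) (t₀ : ℝ) : InfMatrix := fun i j => (genPoly G t₀ i).coeff j

/-- The inverse of a lower triangular infinite matrix with nonzero diagonal entries, by forward
substitution. -/
def lowerInv (T : InfMatrix) : ℕ → ℕ → ℝ
  | i, j => ((if i = j then 1 else 0) - ∑ k : Fin i, T i k * lowerInv T k j) / T i i
termination_by i => i

/-- `lowerInv T` is a right-hand inverse of `T`. -/
theorem matMul_lowerInv (T : InfMatrix) (hT : ∀ i j, i < j → T i j = 0) (hd : ∀ i, T i i ≠ 0) :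
    matMul T (lowerInv T) = 1 := by
  ext i j
  have h : Function.support (fun k => T i k * lowerInv T k j) ⊆ ↑(Finset.range (i + 1)) := by
    intro k hk
    by_contra hk'
    simp only [Finset.coe_range, Set.mem_Iio, not_lt] at hk'
    exact hk (by simp [hT i k (by omega)])
  have e := lowerInv.eq_1 T i j
  rw [eq_div_iff (hd i), Fin.sum_univ_eq_sum_range (fun k => T i k * lowerInv T k j)] at e
  change ∑ᶠ k, T i k * lowerInv T k j = _
  rw [finsum_eq_sum_of_support_subset _ h, Finset.sum_range_succ, mul_comm (T i i), e,
    Matrix.one_apply]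
  ring

/-- `lowerInv T` is lower triangular. -/
theorem lowerInv_eq_zero (T : InfMatrix) (i j : ℕ) (hij : i < j) : lowerInv T i j = 0 := by
  induction i using Nat.strong_induction_on with
  | _ i ih =>
    rw [lowerInv, Finset.sum_eq_zero, if_neg (by omega)]
    · simp
    · intro k _
      rw [ih k k.2 (by omega), mul_zero]

/-- The matrix of formal moments `M_G = T⁻¹ T⁻ᵀ`. -/
def formalMoments (G : InfMatrix) (t₀ : ℝ) : InfMatrix :=
  matMul (lowerInv (coeffMatrix G t₀)) (Matrix.transpose (lowerInv (coeffMatrix G t₀)))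

/-- `G` is a Hessenberg–Sobolev matrix of finite index `d`. -/
def IsHessenbergSobolevOfIndex (G : InfMatrix) (t₀ : ℝ) (d : ℕ) : Prop :=
  IsNondegenerateHessenberg G ∧ IsHankelSobolevOfIndex (formalMoments G t₀) d

/-- The bilinear form `⟨p, q⟩_G = ∑ᵢ ∑ⱼ aᵢ m_{i,j} bⱼ`. -/
def formG (G : InfMatrix) (t₀ : ℝ) (p q : ℝ[X]) : ℝ :=
  p.sum fun i a => q.sum fun j b => a * formalMoments G t₀ i j * b

/-- The Sobolev form `⟨p, q⟩_μ = ∑_{k=0}^{d} ∫ p⁽ᵏ⁾ q⁽ᵏ⁾ dμ_k`. -/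
def sobolevForm {d : ℕ} (μ : Fin (d + 1) → Measure ℝ) (p q : ℝ[X]) : ℝ :=
  ∑ k : Fin (d + 1),
    ∫ x, (derivative^[(k : ℕ)] p).eval x * (derivative^[(k : ℕ)] q).eval x ∂(μ k)

/-- Vectors `(μ_0, …, μ_d)` of finite nonnegative Borel measures on the real line with respect to
which all polynomials are integrable, in the discrete-continuous case: the support of `μ_d` is
infinite and the supports of `μ_0, …, μ_{d-1}` are finite. -/
def IsDiscreteContinuous {d : ℕ} (μ : Fin (d + 1) → Measure ℝ) : Prop :=
  (∀ k, IsFiniteMeasure (μ k)) ∧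
  (∀ k, ∀ p : ℝ[X], Integrable (fun x => p.eval x) (μ k)) ∧
  (μ (Fin.last d)).support.Infinite ∧
  ∀ k : Fin (d + 1), (k : ℕ) < d → (μ k).support.Finite

end

end HessenbergSobolev

open HessenbergSobolev

/-! On monomials, the `k`-th derivative turns `x^i` into a falling factorial times `x^(i-k)`, so `∫
p⁽ᵏ⁾ q⁽ᵏ⁾ dμ` has as its Gram matrix the block `U⁻ᵏ D_k H D_k Uᵏ`, with `H` the Hankel moment matrix
of `μ`. Equality of the two forms therefore says exactly that `M_G` is the sum of the blocks of the
moment matrices of the `μ_k`.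

Such a decomposition is unique. Along an antidiagonal the Hankel factor of block `k` is constant,
and the falling factorials form a polynomial of degree `2k` in the position, with leading
coefficient `(-1)^k`. A difference of order `2d` kills the blocks with `k < d` and returns `(-1)^d
(2d)! H_d` from the top one. Peeling off blocks recovers every `H_k` (`hankelComponent_eq`), and the
problem splits into one moment problem per index.

For a single Hankel matrix, positive determinants of every order mean positivity on nonzero squares,
and Hamburger's theorem supplies a measure, necessarily of infinite support. In the finite-order
case the vanishing determinants must first be shown to give semidefiniteness: they produce a
polynomial `P` of degree `m` with `L(Pq) = 0` for all `q`, and division by `P` reduces squares to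
degrees below `m`. Conversely, the number of support points is the order of the moment matrix.

The orthonormality criterion is the identity `T M_G Tᵀ = 1`, together with the fact that the
generated polynomials form a basis. -/

/-! ### Nonnegative polynomials as sums of squares -/

theorem Polynomial.exists_forall_eval_le_of_nonneg (p : ℝ[X]) (hp : ∀ x, 0 ≤ p.eval x) :
    ∃ a, ∀ x, p.eval a ≤ p.eval x := by
  by_cases hd : 0 < p.degree
  · refine p.continuous.exists_forall_le ?_
    have h1 := p.abs_tendsto_atTop hd
    have h2 := p.abs_tendsto_atBot hd
    simp only [abs_of_nonneg (hp _)] at h1 h2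
    rw [cocompact_eq_atBot_atTop]
    exact h2.sup h1
  · rw [eq_C_of_degree_le_zero (not_lt.mp hd)]
    exact ⟨0, by simp⟩

/-- A real polynomial which is nonnegative on the line is a sum of squares. -/
theorem Polynomial.isSumSq_of_eval_nonneg (p : ℝ[X]) (hp : ∀ x, 0 ≤ p.eval x) : IsSumSq p := by
  induction hn : p.natDegree using Nat.strong_induction_on generalizing p with
  | _ n ih =>
    -- At a minimum point `a` the polynomial `p - p(a)` has a double root, so `p = (X - a)² r +
    -- p(a)`. Here `r` is again nonnegative, at `a` itself by density, and its degree is two less.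
    obtain ⟨a, ha⟩ := p.exists_forall_eval_le_of_nonneg hp
    have hc : IsSumSq (C (p.eval a)) := by
      have : C (p.eval a) = C (√(p.eval a)) * C (√(p.eval a)) := by
        rw [← C_mul, Real.mul_self_sqrt (hp a)]
      rw [this]; exact IsSumSq.mul_self _
    obtain ⟨q, hq⟩ : X - C a ∣ p - C (p.eval a) := X_sub_C_dvd_sub_C_eval
    have hder : q.eval a = 0 := by
      have hmin : IsLocalMin (fun x => p.eval x) a := Filter.Eventually.of_forall ha
      have h0 : p.derivative.eval a = 0 := by
        rw [← Polynomial.deriv]; exact hmin.deriv_eq_zero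
      have := congrArg (fun r => (derivative r).eval a) hq
      simpa [h0] using this.symm
    obtain ⟨r, hr⟩ := dvd_iff_isRoot.2 hder
    have hpr : p = (X - C a) * (X - C a) * r + C (p.eval a) := by
      rw [mul_assoc, ← hr, ← hq]; ring
    by_cases hr0 : r = 0
    · rw [hpr, hr0, mul_zero, zero_add]; exact hc
    have hev : ∀ x, p.eval x = (x - a) * (x - a) * r.eval x + p.eval a := by
      intro x
      conv_lhs => rw [hpr]
      simp
    have hrnn : ∀ x, 0 ≤ r.eval x := by
      have hdense : Dense {x : ℝ | x ≠ a} := dense_compl_singleton a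
      have hcl : IsClosed {x : ℝ | 0 ≤ r.eval x} := isClosed_le continuous_const r.continuous
      intro x
      refine (hcl.closure_subset_iff.2 ?_) (hdense x)
      intro y hy
      have h1 := ha y
      rw [hev y] at h1
      have h2 : 0 < (y - a) * (y - a) := mul_self_pos.2 (sub_ne_zero.2 hy)
      exact nonneg_of_mul_nonneg_right (by linarith) h2
    have hdeg : r.natDegree < n := by
      have h1 : ((X - C a) * (X - C a) * r + C (p.eval a)).natDegree = r.natDegree + 2 := by
        rw [natDegree_add_C, natDegree_mul (by simp [X_sub_C_ne_zero]) hr0,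
          natDegree_mul (X_sub_C_ne_zero a) (X_sub_C_ne_zero a), natDegree_X_sub_C]
        ring
      rw [← hpr] at h1
      omega
    rw [hpr]
    exact ((IsSumSq.mul_self _).mul (ih _ hdeg r hrnn rfl)).add hc

theorem LinearMap.nonneg_of_isSumSq (L : ℝ[X] →ₗ[ℝ] ℝ) (hL : ∀ p, 0 ≤ L (p * p)) {p : ℝ[X]}
    (hp : IsSumSq p) : 0 ≤ L p := by
  induction hp with
  | zero => simp
  | sq_add a _ ih => rw [map_add]; exact add_nonneg (hL a) ih

/-! ### Hamburger's theorem -/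

/-- The functions on the line which are bounded by polynomials. -/
def polynomiallyBounded : Submodule ℝ (ℝ → ℝ) where
  carrier := {f | ∃ p : ℝ[X], ∀ x, |f x| ≤ p.eval x}
  zero_mem' := ⟨0, by simp⟩
  add_mem' := by
    rintro f g ⟨p, hp⟩ ⟨q, hq⟩
    refine ⟨p + q, fun x => ?_⟩
    rw [eval_add]
    exact (abs_add_le _ _).trans (add_le_add (hp x) (hq x))
  smul_mem' := by
    rintro c f ⟨p, hp⟩
    refine ⟨C |c| * p, fun x => ?_⟩
    simp only [Pi.smul_apply, smul_eq_mul, abs_mul, eval_mul, eval_C]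
    exact mul_le_mul_of_nonneg_left (hp x) (abs_nonneg c)

theorem eval_mem_polynomiallyBounded (p : ℝ[X]) :
    (fun x => p.eval x) ∈ polynomiallyBounded := by
  refine ⟨p * p + 1, fun x => ?_⟩
  simp only [eval_add, eval_mul, eval_one]
  rw [abs_le]
  constructor <;> nlinarith [sq_nonneg (p.eval x + 1), sq_nonneg (p.eval x - 1)]

/-- Polynomials as polynomially bounded functions. -/
noncomputable def polynomialEval : ℝ[X] →ₗ[ℝ] polynomiallyBounded where
  toFun p := ⟨fun x => p.eval x, eval_mem_polynomiallyBounded p⟩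
  map_add' p q := by ext x; simp
  map_smul' c p := by ext x; simp

theorem polynomialEval_injective : Function.Injective polynomialEval := fun _ _ h =>
  Polynomial.funext fun x => congrFun (congrArg Subtype.val h) x

/-- M. Riesz extension: every function in the space is dominated by a polynomial, so the polynomials
are cofinal for the cone of nonnegative functions, and on them positivity is the sum-of-squares
theorem. -/
theorem exists_nonneg_extension (L : ℝ[X] →ₗ[ℝ] ℝ) (hL : ∀ p : ℝ[X], 0 ≤ L (p * p)) :
    ∃ Λ : polynomiallyBounded →ₗ[ℝ] ℝ, (∀ p, Λ (polynomialEval p) = L p) ∧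
      ∀ f : polynomiallyBounded, (∀ x, 0 ≤ f.1 x) → 0 ≤ Λ f := by
  let s : PointedCone ℝ polynomiallyBounded :=
    { carrier := {f | ∀ x, 0 ≤ f.1 x}
      zero_mem' := fun x => le_rfl
      add_mem' := fun {f g} hf hg x => add_nonneg (hf x) (hg x)
      smul_mem' := fun c f hf x => mul_nonneg c.2 (hf x) }
  let e := LinearEquiv.ofInjective polynomialEval polynomialEval_injective
  let f : polynomiallyBounded →ₗ.[ℝ] ℝ :=
    ⟨LinearMap.range polynomialEval, L ∘ₗ e.symm.toLinearMap⟩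
  have hf : ∀ p, f (e p) = L p := fun p => by
    change L (e.symm (e p)) = L p
    rw [e.symm_apply_apply]
  have hf0 : ∀ x : f.domain, (x : polynomiallyBounded) ∈ s → 0 ≤ f x := by
    rintro ⟨_, p, rfl⟩ hx
    refine le_of_le_of_eq ?_ (hf p).symm
    exact L.nonneg_of_isSumSq hL (p.isSumSq_of_eval_nonneg hx)
  have hdense : ∀ y, ∃ x : f.domain, (x : polynomiallyBounded) + y ∈ s := by
    rintro ⟨g, p, hp⟩
    refine ⟨e p, fun x => ?_⟩
    change 0 ≤ p.eval x + g x
    linarith [(abs_le.1 (hp x)).1]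
  obtain ⟨Λ, h1, h2⟩ := riesz_extension s f hf0 hdense
  exact ⟨Λ, fun p => (h1 (e p)).trans (hf p), fun g hg => h2 g hg⟩

/-- A trapezoidal cutoff function, equal to one on `[-n, n]`. -/
noncomputable def trapezoid (n : ℕ) (x : ℝ) : ℝ := max 0 (min 1 (n + 1 - |x|))

theorem trapezoid_continuous (n : ℕ) : Continuous (trapezoid n) := by
  unfold trapezoid; fun_prop

theorem trapezoid_nonneg (n : ℕ) (x : ℝ) : 0 ≤ trapezoid n x := le_max_left _ _

theorem trapezoid_le_one (n : ℕ) (x : ℝ) : trapezoid n x ≤ 1 :=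
  max_le zero_le_one (min_le_left _ _)

theorem trapezoid_eq_one {n : ℕ} {x : ℝ} (h : |x| ≤ n) : trapezoid n x = 1 := by
  rw [trapezoid, min_eq_left (by linarith), max_eq_right zero_le_one]

theorem trapezoid_tendsto (x : ℝ) :
    Filter.Tendsto (fun n => trapezoid n x) Filter.atTop (nhds 1) := by
  obtain ⟨N, hN⟩ := exists_nat_ge |x|
  refine tendsto_const_nhds.congr' ?_
  filter_upwards [Filter.eventually_ge_atTop N] with n hn
  exact (trapezoid_eq_one (hN.trans (by exact_mod_cast hn))).symm

theorem trapezoid_hasCompactSupport (n : ℕ) : HasCompactSupport (trapezoid n) := by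
  refine HasCompactSupport.of_support_subset_isCompact (isCompact_Icc (a := -(n + 1 : ℝ))
    (b := n + 1)) fun x hx => ?_
  by_contra h
  refine hx ?_
  have h1 : (n : ℝ) + 1 - |x| ≤ 0 := by
    by_contra h2
    exact h (abs_le.1 (by linarith))
  rw [trapezoid, max_eq_left]
  exact (min_le_right _ _).trans h1

theorem compactlySupported_mem_polynomiallyBounded (f : CompactlySupportedContinuousMap ℝ ℝ) :
    (f : ℝ → ℝ) ∈ polynomiallyBounded := by
  obtain ⟨c, hc⟩ := f.hasCompactSupport.exists_bound_of_continuous f.continuous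
  exact ⟨C c, fun x => by simpa using hc x⟩

/-- **Hamburger's theorem**: a linear functional on real polynomials which is nonnegative on
squares is given by a measure. -/
theorem exists_measure_of_nonneg_sq (L : ℝ[X] →ₗ[ℝ] ℝ) (hL : ∀ p : ℝ[X], 0 ≤ L (p * p)) :
    ∃ μ : Measure ℝ, (∀ p : ℝ[X], Integrable (fun x => p.eval x) μ) ∧
      ∀ p : ℝ[X], ∫ x, p.eval x ∂μ = L p := by
  obtain ⟨Λ, hΛ, hΛ0⟩ := exists_nonneg_extension L hL
  let Λc : CompactlySupportedContinuousMap ℝ ℝ →ₚ[ℝ] ℝ := PositiveLinearMap.mk₀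
    { toFun := fun f => Λ ⟨f, compactlySupported_mem_polynomiallyBounded f⟩
      map_add' := fun f g => by rw [← map_add]; rfl
      map_smul' := fun c f => by rw [RingHom.id_apply, ← map_smul]; rfl }
    fun f hf => hΛ0 _ fun x => hf x
  -- This measure is built from compactly supported functions only; it remains to show that no mass
  -- of `L` escapes to infinity.
  let μ := RealRMK.rieszMeasure Λc
  let cut (p : ℝ[X]) (n : ℕ) : CompactlySupportedContinuousMap ℝ ℝ :=
    ⟨⟨fun x => p.eval x * trapezoid n x, p.continuous.mul (trapezoid_continuous n)⟩,
      (trapezoid_hasCompactSupport n).mul_left⟩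
  have hcut : ∀ (p : ℝ[X]) n, ∫ x, p.eval x * trapezoid n x ∂μ =
      Λ ⟨cut p n, compactlySupported_mem_polynomiallyBounded _⟩ :=
    fun p n => RealRMK.integral_rieszMeasure Λc (cut p n)
  have hcutint : ∀ (p : ℝ[X]) n, Integrable (fun x => p.eval x * trapezoid n x) μ := fun p n =>
    (p.continuous.mul (trapezoid_continuous n)).integrable_of_hasCompactSupport
      (trapezoid_hasCompactSupport n).mul_left
  have hmono : ∀ f g : polynomiallyBounded, (∀ x, f.1 x ≤ g.1 x) → Λ f ≤ Λ g := by
    intro f g h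
    have := hΛ0 (g - f) fun x => sub_nonneg.2 (h x)
    rw [map_sub] at this
    linarith
  have hle : ∀ p : ℝ[X], (∀ x, 0 ≤ p.eval x) → ∀ n,
      ∫ x, p.eval x * trapezoid n x ∂μ ≤ L p := by
    intro p hp n
    rw [hcut, ← hΛ]
    exact hmono _ _ fun x => mul_le_of_le_one_right (hp x) (trapezoid_le_one n x)
  have htend : ∀ (p : ℝ[X]) x, Filter.Tendsto (fun n => p.eval x * trapezoid n x)
      Filter.atTop (nhds (p.eval x)) := by
    intro p x
    simpa using (trapezoid_tendsto x).const_mul (p.eval x)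
  -- Fatou's lemma: the truncated integrals stay below `L p`.
  have hint0 : ∀ p : ℝ[X], (∀ x, 0 ≤ p.eval x) → Integrable (fun x => p.eval x) μ := by
    intro p hp
    refine integrable_of_tendsto (G := fun n x => p.eval x * trapezoid n x)
      (Filter.Eventually.of_forall (htend p)) (fun n => (hcutint p n).aestronglyMeasurable) ?_
    refine ne_top_of_le_ne_top (b := ENNReal.ofReal (L p)) ENNReal.ofReal_ne_top ?_
    refine Filter.liminf_le_of_frequently_le' (Filter.Frequently.of_forall fun n => ?_)
    have h0 : ∀ x, 0 ≤ p.eval x * trapezoid n x :=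
      fun x => mul_nonneg (hp x) (trapezoid_nonneg n x)
    simp only [Real.enorm_of_nonneg (h0 _)]
    rw [← ofReal_integral_eq_lintegral_ofReal (hcutint p n) (Filter.Eventually.of_forall h0)]
    exact ENNReal.ofReal_le_ofReal (hle p hp n)
  have hval0 : ∀ p : ℝ[X], (∀ x, 0 ≤ p.eval x) → ∫ x, p.eval x ∂μ = L p := by
    intro p hp
    have h1 : Filter.Tendsto (fun n => ∫ x, p.eval x * trapezoid n x ∂μ) Filter.atTop
        (nhds (∫ x, p.eval x ∂μ)) := by
      refine tendsto_integral_of_dominated_convergence (fun x => p.eval x)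
        (fun n => (hcutint p n).aestronglyMeasurable) (hint0 p hp) (fun n => ?_)
        (Filter.Eventually.of_forall (htend p))
      refine Filter.Eventually.of_forall fun x => ?_
      rw [Real.norm_of_nonneg (mul_nonneg (hp x) (trapezoid_nonneg n x))]
      exact mul_le_of_le_one_right (hp x) (trapezoid_le_one n x)
    -- Chebyshev-type bound: `p (1 - x²/(n+1)²)` lies below the truncation of `p`, since it is at
    -- most `p` where the cutoff is one and nonpositive for `|x| > n + 1`. Its value under `L` tends
    -- to `L p`.
    have h2 : ∀ n : ℕ, L p - L (p * X ^ 2) * ((n : ℝ) + 1)⁻¹ ^ 2 ≤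
        ∫ x, p.eval x * trapezoid (n + 1) x ∂μ := by
      intro n
      have e : L p - L (p * X ^ 2) * ((n : ℝ) + 1)⁻¹ ^ 2 =
          Λ (polynomialEval (p - (((n : ℝ) + 1)⁻¹ ^ 2) • (p * X ^ 2))) := by
        rw [hΛ, map_sub, map_smul, smul_eq_mul, mul_comm]
      rw [hcut, e]
      refine hmono _ _ fun x => ?_
      change eval x (p - (((n : ℝ) + 1)⁻¹ ^ 2) • (p * X ^ 2)) ≤ p.eval x * trapezoid (n + 1) x
      simp only [eval_sub, eval_smul, eval_mul, eval_pow, eval_X, smul_eq_mul]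
      have hn : (0 : ℝ) < n + 1 := by positivity
      by_cases hx : |x| ≤ (n + 1 : ℕ)
      · rw [trapezoid_eq_one hx, mul_one]
        have := mul_nonneg (sq_nonneg ((n : ℝ) + 1)⁻¹) (mul_nonneg (hp x) (sq_nonneg x))
        linarith
      · refine le_trans ?_ (mul_nonneg (hp x) (trapezoid_nonneg _ x))
        have h3 : 1 ≤ ((n : ℝ) + 1)⁻¹ ^ 2 * x ^ 2 := by
          rw [← mul_pow, ← sq_abs, abs_mul, abs_inv, abs_of_pos hn]
          refine one_le_pow₀ ?_
          rw [inv_mul_eq_div, one_le_div hn]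
          push_cast at hx
          linarith
        nlinarith [hp x]
    have h3 : Filter.Tendsto (fun n : ℕ => L p - L (p * X ^ 2) * ((n : ℝ) + 1)⁻¹ ^ 2)
        Filter.atTop (nhds (L p)) := by
      have h4 : Filter.Tendsto (fun n : ℕ => ((n : ℝ) + 1)⁻¹) Filter.atTop (nhds 0) := by
        simpa using tendsto_one_div_add_atTop_nhds_zero_nat (𝕜 := ℝ)
      simpa using ((h4.pow 2).const_mul (L (p * X ^ 2))).const_sub (L p)
    refine tendsto_nhds_unique ((Filter.tendsto_add_atTop_iff_nat 1).2 h1) ?_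
    exact tendsto_of_tendsto_of_tendsto_of_le_of_le h3 tendsto_const_nhds h2 fun n => hle p hp _
  -- Every polynomial is a difference of two nonnegative ones, which removes the sign assumption.
  have hsplit : ∀ p : ℝ[X], p = (4 : ℝ)⁻¹ • ((p + 1) ^ 2 - (p - 1) ^ 2) := by
    intro p
    refine Polynomial.funext fun x => ?_
    simp only [eval_smul, eval_sub, eval_pow, eval_add, eval_one, smul_eq_mul]
    ring
  have hsq : ∀ (p : ℝ[X]) x, 0 ≤ (p ^ 2).eval x := fun p x => by
    rw [eval_pow]; exact sq_nonneg _
  have hfun : ∀ p : ℝ[X], (fun x => p.eval x) =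
      fun x => (4 : ℝ)⁻¹ * (((p + 1) ^ 2).eval x - ((p - 1) ^ 2).eval x) := by
    intro p
    funext x
    conv_lhs => rw [hsplit p]
    simp only [eval_smul, eval_sub, smul_eq_mul]
  refine ⟨μ, fun p => ?_, fun p => ?_⟩
  · rw [hfun p]
    exact ((hint0 _ (hsq _)).sub (hint0 _ (hsq _))).const_mul _
  · rw [hfun p, integral_const_mul, integral_sub (hint0 _ (hsq _)) (hint0 _ (hsq _)),
      hval0 _ (hsq _), hval0 _ (hsq _), ← map_sub, ← smul_eq_mul, ← map_smul, ← hsplit p]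

/-! ### Hankel determinants and positivity of the moment functional -/

theorem HessenbergSobolev.IsHankel.eq_zero_add {H : InfMatrix} (hH : IsHankel H) (i j : ℕ) :
    H i j = H 0 (i + j) := by
  induction i generalizing j with
  | zero => rw [zero_add]
  | succ i ih => rw [← hH, ih, Nat.add_right_comm, Nat.add_assoc]

/-- The linear functional on polynomials with moments `H 0 0, H 0 1, …`. -/
noncomputable def momentFunctional (H : InfMatrix) : ℝ[X] →ₗ[ℝ] ℝ :=
  Polynomial.lsum fun n => H 0 n • LinearMap.id

theorem momentFunctional_X_pow (H : InfMatrix) (n : ℕ) : momentFunctional H (X ^ n) = H 0 n := by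
  rw [← monomial_one_right_eq_X_pow, momentFunctional, lsum_apply, sum_monomial_index]
  · simp
  · simp

theorem HessenbergSobolev.IsHankel.momentFunctional_mul {H : InfMatrix} (hH : IsHankel H)
    (i j : ℕ) : momentFunctional H (X ^ i * X ^ j) = H i j := by
  rw [← pow_add, momentFunctional_X_pow, ← hH.eq_zero_add]

/-- The polynomial with coefficients `v 0, …, v (n - 1)`. -/
noncomputable def finPoly {n : ℕ} (v : Fin n → ℝ) : ℝ[X] := ∑ j, C (v j) * X ^ (j : ℕ)

theorem finPoly_coeff {n : ℕ} (v : Fin n → ℝ) (i : Fin n) : (finPoly v).coeff i = v i := by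
  simp [finPoly, coeff_X_pow, Fin.val_inj]

theorem finPoly_degree_lt {n : ℕ} (v : Fin n → ℝ) : (finPoly v).degree < n := by
  rw [degree_lt_iff_coeff_zero]
  intro m hm
  rw [finPoly, finsetSum_coeff]
  refine Finset.sum_eq_zero fun i _ => ?_
  rw [coeff_C_mul, coeff_X_pow, if_neg (by omega), mul_zero]

theorem finPoly_of_coeff {n : ℕ} {p : ℝ[X]} (hp : p.degree < n) :
    finPoly (fun i : Fin n => p.coeff i) = p := by
  ext m
  by_cases hm : m < n
  · exact finPoly_coeff _ ⟨m, hm⟩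
  · rw [(degree_lt_iff_coeff_zero _ _).1 (finPoly_degree_lt _) m (not_lt.1 hm),
      (degree_lt_iff_coeff_zero _ _).1 hp m (not_lt.1 hm)]

theorem finPoly_eq_zero {n : ℕ} {v : Fin n → ℝ} : finPoly v = 0 ↔ v = 0 := by
  constructor
  · intro h
    ext i
    rw [← finPoly_coeff v i, h, coeff_zero, Pi.zero_apply]
  · rintro rfl
    simp [finPoly]

theorem LinearMap.map_mul_finPoly (L : ℝ[X] →ₗ[ℝ] ℝ) (q : ℝ[X]) {n : ℕ} (v : Fin n → ℝ) :
    L (q * finPoly v) = ∑ j, v j * L (q * X ^ (j : ℕ)) := by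
  rw [finPoly, Finset.mul_sum, map_sum]
  refine Finset.sum_congr rfl fun j _ => ?_
  rw [mul_left_comm, ← smul_eq_C_mul, map_smul, smul_eq_mul]

theorem HessenbergSobolev.IsHankel.leading_mulVec {H : InfMatrix} (hH : IsHankel H) {n : ℕ}
    (v : Fin n → ℝ) (i : Fin n) : (leading H n).mulVec v i = momentFunctional H (X ^ (i : ℕ) * finPoly v) := by
  rw [LinearMap.map_mul_finPoly]
  change ∑ j : Fin n, H i j * v j = _
  refine Finset.sum_congr rfl fun j _ => ?_
  rw [hH.momentFunctional_mul, mul_comm]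

theorem LinearMap.map_mul_of_degree_lt (L : ℝ[X] →ₗ[ℝ] ℝ) {p q : ℝ[X]} {n : ℕ}
    (hq : q.degree < n) : L (p * q) = ∑ i ∈ Finset.range n, q.coeff i * L (X ^ i * p) := by
  conv_lhs => rw [← finPoly_of_coeff hq]
  rw [LinearMap.map_mul_finPoly, Finset.sum_range]
  refine Finset.sum_congr rfl fun i _ => ?_
  rw [mul_comm p]

/-- Positivity of a functional on the squares of nonzero polynomials of degree less than `n`. -/
def PositiveBelow (L : ℝ[X] →ₗ[ℝ] ℝ) (n : ℕ) : Prop :=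
  ∀ p : ℝ[X], p.degree < n → p ≠ 0 → 0 < L (p * p)

theorem HessenbergSobolev.IsHankel.det_pos {H : InfMatrix} (hH : IsHankel H) {n : ℕ}
    (hL : PositiveBelow (momentFunctional H) n) : 0 < (leading H n).det := by
  refine Matrix.PosDef.det_pos (Matrix.PosDef.of_dotProduct_mulVec_pos ?_ fun v hv => ?_)
  · ext i j
    change H j i = H i j
    rw [hH.eq_zero_add, hH.eq_zero_add i, add_comm]
  · have h := hL (finPoly v) (finPoly_degree_lt v) (mt finPoly_eq_zero.1 hv)
    rw [LinearMap.map_mul_finPoly] at h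
    refine lt_of_lt_of_eq h (Finset.sum_congr rfl fun j _ => ?_)
    rw [hH.leading_mulVec, star_trivial, mul_comm (X ^ (j : ℕ))]

/-- Inductive step of Sylvester's criterion. The last column of the adjugate is an orthogonal
polynomial of degree `n`: its leading coefficient is `det [H]_n` and its square has value `det [H]_n
· det [H]_(n+1)`. Any `p` of degree at most `n` is a multiple of it plus an orthogonal remainder of
degree below `n`. -/
theorem HessenbergSobolev.IsHankel.positiveBelow_succ {H : InfMatrix} (hH : IsHankel H) {n : ℕ}
    (hL : PositiveBelow (momentFunctional H) n) (hdet : 0 < (leading H (n + 1)).det) :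
    PositiveBelow (momentFunctional H) (n + 1) := by
  set L := momentFunctional H
  set A := leading H (n + 1)
  let v : Fin (n + 1) → ℝ := fun i => A.adjugate i (Fin.last n)
  have hAv : ∀ i : Fin (n + 1), L (X ^ (i : ℕ) * finPoly v) =
      if i = Fin.last n then A.det else 0 := by
    intro i
    rw [← hH.leading_mulVec]
    have := congrFun (congrFun A.mul_adjugate i) (Fin.last n)
    rw [Matrix.smul_apply, Matrix.one_apply, smul_eq_mul, mul_ite, mul_one, mul_zero] at this
    exact this
  have hvn : 0 < v (Fin.last n) := by
    have h : v (Fin.last n) = (leading H n).det := by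
      change A.adjugate _ _ = _
      rw [Matrix.adjugate_fin_succ_eq_det_submatrix, Even.neg_one_pow (by simp), one_mul]
      simp only [Fin.succAbove_last]
      rfl
    rw [h]
    exact hH.det_pos hL
  have horth : ∀ q : ℝ[X], q.degree < (n + 1 : ℕ) → L (finPoly v * q) = q.coeff n * A.det := by
    intro q hq
    rw [L.map_mul_of_degree_lt hq, Finset.sum_range, Finset.sum_eq_single (Fin.last n)]
    · rw [hAv, if_pos rfl, Fin.val_last]
    · intro i _ hi
      rw [hAv, if_neg hi, mul_zero]
    · simp
  have hvc : (finPoly v).coeff n = v (Fin.last n) := finPoly_coeff v (Fin.last n)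
  intro p hp hp0
  set α := p.coeff n / v (Fin.last n) with hα
  set b := p - C α * finPoly v with hb
  have hbc : b.coeff n = 0 := by
    rw [hb, coeff_sub, coeff_C_mul, hvc, hα, div_mul_cancel₀ _ hvn.ne', sub_self]
  have hbd' : b.degree < (n + 1 : ℕ) := by
    refine (degree_sub_le _ _).trans_lt (max_lt hp ?_)
    rw [← smul_eq_C_mul]
    exact (degree_smul_le _ _).trans_lt (finPoly_degree_lt v)
  have hbd : b.degree < n := by
    rw [degree_lt_iff_coeff_zero] at hbd' ⊢
    intro m hm
    rcases hm.eq_or_lt with rfl | hm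
    · exact hbc
    · exact hbd' m hm
  have hpb : p = α • finPoly v + b := by rw [hb, smul_eq_C_mul]; ring
  have hpp : L (p * p) = α ^ 2 * (v (Fin.last n) * A.det) + L (b * b) := by
    have e : p * p = α ^ 2 • (finPoly v * finPoly v) + (2 * α) • (finPoly v * b) + b * b := by
      rw [hpb]; simp only [smul_eq_C_mul, C_mul, C_pow, C_ofNat]; ring
    rw [e, map_add, map_add, map_smul, map_smul, horth _ (finPoly_degree_lt v), horth b hbd', hbc,
      hvc]
    simp
  rw [hpp]
  by_cases hb0 : b = 0
  · have hα0 : α ≠ 0 := by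
      rintro h
      rw [h, hb0, zero_smul, zero_add] at hpb
      exact hp0 hpb
    rw [hb0, mul_zero, map_zero, add_zero]
    positivity
  · have := hL b hbd hb0
    positivity

theorem HessenbergSobolev.IsHankel.positiveBelow {H : InfMatrix} (hH : IsHankel H) (n : ℕ)
    (h : ∀ k, 1 ≤ k → k ≤ n → 0 < (leading H k).det) :
    PositiveBelow (momentFunctional H) n := by
  induction n with
  | zero =>
    intro p hp hp0
    rw [Nat.cast_zero, ← not_le, zero_le_degree_iff, not_not] at hp
    exact absurd hp hp0
  | succ n ih =>
    exact hH.positiveBelow_succ (ih fun k h1 h2 => h k h1 (by omega)) (h _ (by omega) le_rfl)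

theorem HessenbergSobolev.IsHankel.det_eq_zero_iff {H : InfMatrix} (hH : IsHankel H) (n : ℕ) :
    (leading H n).det = 0 ↔ ∃ p : ℝ[X], p ≠ 0 ∧ p.degree < n ∧
      ∀ q : ℝ[X], q.degree < n → momentFunctional H (p * q) = 0 := by
  rw [← Matrix.exists_mulVec_eq_zero_iff]
  constructor
  · rintro ⟨v, hv, hAv⟩
    refine ⟨finPoly v, mt finPoly_eq_zero.1 hv, finPoly_degree_lt v, fun q hq => ?_⟩
    rw [LinearMap.map_mul_of_degree_lt _ hq]
    refine Finset.sum_eq_zero fun i hi => ?_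
    rw [← hH.leading_mulVec v ⟨i, Finset.mem_range.1 hi⟩, hAv, Pi.zero_apply, mul_zero]
  · rintro ⟨p, hp0, hp, h⟩
    refine ⟨fun i => p.coeff i, fun h0 => hp0 ?_, ?_⟩
    · rw [← finPoly_of_coeff hp, finPoly_eq_zero.2 h0]
    · ext i
      rw [hH.leading_mulVec, finPoly_of_coeff hp, mul_comm, Pi.zero_apply]
      refine h _ ?_
      rw [degree_X_pow]
      exact_mod_cast i.2

/-- If the Hankel determinants are positive up to order `m` and vanish afterwards, then the
functional is annihilated by a monic polynomial of degree `m`. -/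
theorem HessenbergSobolev.IsHankel.exists_monic_annihilator {H : InfMatrix} (hH : IsHankel H)
    {m : ℕ} (h : PosDefOfOrder H m) : ∃ P : ℝ[X], P.Monic ∧ P.degree = m ∧
      ∀ q : ℝ[X], momentFunctional H (P * q) = 0 := by
  set L := momentFunctional H
  have hpos : PositiveBelow L m := hH.positiveBelow m h.1
  -- A kernel polynomial of order `m + 1` has degree exactly `m`, since `L` is positive on nonzero
  -- squares below degree `m`.
  obtain ⟨p, hp0, hp, hpL⟩ := (hH.det_eq_zero_iff (m + 1)).1 (h.2 (m + 1) (Nat.lt_succ_self m))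
  have hdeg : p.degree = m := by
    have hle : p.natDegree ≤ m := Nat.lt_succ_iff.1 ((natDegree_lt_iff_degree_lt hp0).2 hp)
    refine le_antisymm (natDegree_le_iff_degree_le.1 hle) (not_lt.1 fun hlt => ?_)
    exact (hpos p hlt hp0).ne' (hpL p hp)
  have hlc : p.leadingCoeff ≠ 0 := leadingCoeff_ne_zero.2 hp0
  set P := p * C p.leadingCoeff⁻¹ with hP
  have hPm : P.Monic := monic_mul_leadingCoeff_inv hp0
  have hPd : P.degree = m := by rw [hP, degree_mul_leadingCoeff_inv _ hp0, hdeg]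
  have hPn : P.natDegree = m := natDegree_eq_of_degree_eq_some hPd
  have hbase : ∀ q : ℝ[X], q.degree < (m + 1 : ℕ) → L (P * q) = 0 := by
    intro q hq
    rw [hP, mul_assoc, mul_left_comm, ← smul_eq_C_mul, map_smul, hpL q hq, smul_zero]
  have hall : ∀ j, L (X ^ j * P) = 0 := by
    intro j
    induction j using Nat.strong_induction_on with
    | _ j ih =>
      by_cases hj : j < m + 1
      · rw [mul_comm]
        refine hbase _ ?_
        rw [degree_X_pow]
        exact_mod_cast hj
      obtain ⟨r, rfl⟩ : ∃ r, j = m + r := ⟨j - m, by omega⟩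
      have hlow : ∀ s : ℝ[X], s.degree < (m + r : ℕ) → L (P * s) = 0 := by
        intro s hs
        rw [L.map_mul_of_degree_lt hs]
        exact Finset.sum_eq_zero fun i hi => by rw [ih i (Finset.mem_range.1 hi), mul_zero]
      -- The next singular truncation gives a kernel polynomial `q = b + P a`; it is shown to be a
      -- multiple of `P` and then used to obtain the one missing relation `L(X^(m+r) P) = 0`.
      obtain ⟨q, hq0, hq, hqL⟩ := (hH.det_eq_zero_iff (m + r + 1)).1 (h.2 _ (by omega))
      set a := q /ₘ P with ha
      set b := q %ₘ P with hb
      have hqab : q = b + P * a := (modByMonic_add_div q P).symm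
      have hbd : b.degree < m := hPd ▸ degree_modByMonic_lt q hPm
      have had : a.natDegree ≤ r := by
        rw [ha, natDegree_divByMonic q hPm, hPn]
        have := (natDegree_lt_iff_degree_lt hq0).2 hq
        omega
      have hb0 : b = 0 := by
        by_contra hb0
        refine (hpos b hbd hb0).ne' ?_
        have hbn : b.natDegree < m := (natDegree_lt_iff_degree_lt hb0).2 hbd
        have h1 : L (q * b) = 0 := hqL b (hbd.trans_le (by exact_mod_cast (by omega)))
        -- The product `a b` has degree below `m + r`, so the induction hypothesis applies and
        -- leaves `L(b²) = 0`.
        have h2 : L (P * (a * b)) = 0 := by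
          refine hlow _ (lt_of_le_of_lt degree_le_natDegree ?_)
          refine Nat.cast_lt.2 (natDegree_mul_le.trans_lt (by omega))
        rw [hqab, add_mul, map_add, mul_assoc, h2, add_zero] at h1
        exact h1
      rw [hb0, zero_add] at hqab
      have ha0 : a ≠ 0 := by
        rintro h0
        rw [h0, mul_zero] at hqab
        exact hq0 hqab
      -- The power of `X` is chosen to give `t` degree exactly `m + r`. Since `P t = q · X^(r - deg
      -- a) P`, the kernel property gives `L(P t) = 0`, and by induction only the leading term of
      -- `t` contributes.
      set t := a * (X ^ (r - a.natDegree) * P) with ht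
      have hXP : (X ^ (r - a.natDegree) * P).Monic := (monic_X_pow _).mul hPm
      have hXPn : (X ^ (r - a.natDegree) * P).natDegree = r - a.natDegree + m := by
        rw [(monic_X_pow _).natDegree_mul hPm, natDegree_X_pow, hPn]
      have htn : t.natDegree = m + r := by
        rw [ht, natDegree_mul ha0 hXP.ne_zero, hXPn]
        omega
      have htc : t.coeff (m + r) = a.leadingCoeff := by
        rw [← htn, coeff_natDegree, ht, leadingCoeff_mul, hXP.leadingCoeff, mul_one]
      have h1 : L (P * t) = 0 := by
        rw [ht, ← mul_assoc, ← hqab]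
        refine hqL _ (lt_of_le_of_lt degree_le_natDegree (Nat.cast_lt.2 ?_))
        omega
      have htd : t.degree < (m + r + 1 : ℕ) :=
        lt_of_le_of_lt degree_le_natDegree (Nat.cast_lt.2 (by omega))
      rw [L.map_mul_of_degree_lt htd, Finset.sum_range_succ, Finset.sum_eq_zero, zero_add,
        htc] at h1
      · exact (mul_eq_zero.1 h1).resolve_left (leadingCoeff_ne_zero.2 ha0)
      · intro i hi
        rw [ih i (Finset.mem_range.1 hi), mul_zero]
  refine ⟨P, hPm, hPd, fun q => ?_⟩
  rw [L.map_mul_of_degree_lt (lt_of_le_of_lt degree_le_natDegree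
    (Nat.cast_lt.2 q.natDegree.lt_succ_self))]
  exact Finset.sum_eq_zero fun i _ => by rw [hall, mul_zero]

/-- Modulo multiples of the annihilator `P`, the square of `p` is the square of its remainder, whose
degree is below `m`, where `L` is positive. -/
theorem HessenbergSobolev.IsHankel.sq_nonneg_of_posDefOfOrder {H : InfMatrix} (hH : IsHankel H)
    {m : ℕ} (h : PosDefOfOrder H m) (p : ℝ[X]) : 0 ≤ momentFunctional H (p * p) := by
  obtain ⟨P, hPm, hPd, hP⟩ := hH.exists_monic_annihilator h
  have e : p * p = p %ₘ P * (p %ₘ P) + P * (p /ₘ P * (p + p %ₘ P)) := by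
    have := modByMonic_add_div p P
    linear_combination (-(p + p %ₘ P)) * this
  rw [e, map_add, hP, add_zero]
  by_cases hb : p %ₘ P = 0
  · simp [hb]
  · exact (hH.positiveBelow m h.1 _ (hPd ▸ degree_modByMonic_lt p hPm) hb).le

/-! ### Size of the support of a representing measure -/

theorem Polynomial.support_subset_rootSet_of_ae {μ : Measure ℝ} {p : ℝ[X]} (hp : p ≠ 0)
    (h : ∀ᵐ x ∂μ, p.eval x = 0) : μ.support ⊆ p.roots.toFinset := by
  intro x hx
  have hcl : IsClosed {x : ℝ | p.eval x = 0} := isClosed_eq p.continuous continuous_const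
  simpa [hp] using Measure.support_subset_of_isClosed hcl h hx

theorem Polynomial.ae_eval_eq_zero_of_integral_mul_self {μ : Measure ℝ} {p : ℝ[X]}
    (hint : Integrable (fun x => (p * p).eval x) μ) (h : ∫ x, (p * p).eval x ∂μ = 0) :
    ∀ᵐ x ∂μ, p.eval x = 0 := by
  rw [integral_eq_zero_iff_of_nonneg (fun x => by
    simpa using mul_self_nonneg (p.eval x)) hint] at h
  filter_upwards [h] with x hx
  simpa using hx

theorem Polynomial.finite_support_of_integral_mul_self {μ : Measure ℝ} {p : ℝ[X]} (hp : p ≠ 0)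
    (hint : Integrable (fun x => (p * p).eval x) μ) (h : ∫ x, (p * p).eval x ∂μ = 0) :
    μ.support.Finite ∧ (μ.support.ncard : WithBot ℕ) ≤ p.degree := by
  have hs := support_subset_rootSet_of_ae hp (ae_eval_eq_zero_of_integral_mul_self hint h)
  refine ⟨p.roots.toFinset.finite_toSet.subset hs, ?_⟩
  rw [degree_eq_natDegree hp, Nat.cast_le]
  refine (Set.ncard_le_ncard hs (Finset.finite_toSet _)).trans ?_
  rw [Set.ncard_coe_finset]
  exact (Multiset.toFinset_card_le _).trans p.card_roots'

theorem isFiniteMeasure_of_integrable_eval {μ : Measure ℝ}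
    (h : ∀ p : ℝ[X], Integrable (fun x => p.eval x) μ) : IsFiniteMeasure μ := by
  have h1 := h 1
  simp only [eval_one] at h1
  exact (integrable_const_iff_isFiniteMeasure one_ne_zero).1 h1

/-- The annihilator satisfies `L(P²) = 0`, which confines the support of the representing measure to
the zeros of `P`. -/
theorem HessenbergSobolev.IsHankel.exists_measure_of_posDefOfOrder {H : InfMatrix}
    (hH : IsHankel H) {m : ℕ} (h : PosDefOfOrder H m) :
    ∃ μ : Measure ℝ, (∀ p : ℝ[X], Integrable (fun x => p.eval x) μ) ∧ μ.support.Finite ∧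
      ∀ p : ℝ[X], ∫ x, p.eval x ∂μ = momentFunctional H p := by
  obtain ⟨μ, hint, hμ⟩ := exists_measure_of_nonneg_sq _ (hH.sq_nonneg_of_posDefOfOrder h)
  obtain ⟨P, hPm, -, hP⟩ := hH.exists_monic_annihilator h
  refine ⟨μ, hint, ?_, hμ⟩
  exact (finite_support_of_integral_mul_self hPm.ne_zero (hint _) (by rw [hμ, hP])).1

theorem HessenbergSobolev.IsHankel.exists_measure_of_posDefInfinite {H : InfMatrix}
    (hH : IsHankel H) (h : PosDefInfinite H) :
    ∃ μ : Measure ℝ, (∀ p : ℝ[X], Integrable (fun x => p.eval x) μ) ∧ μ.support.Infinite ∧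
      ∀ p : ℝ[X], ∫ x, p.eval x ∂μ = momentFunctional H p := by
  have hpos : ∀ p : ℝ[X], p ≠ 0 → 0 < momentFunctional H (p * p) := fun p hp =>
    hH.positiveBelow (p.natDegree + 1) (fun k hk _ => h k hk) p
      (lt_of_le_of_lt degree_le_natDegree (Nat.cast_lt.2 (Nat.lt_succ_self _))) hp
  obtain ⟨μ, hint, hμ⟩ := exists_measure_of_nonneg_sq (momentFunctional H) fun p => by
    by_cases hp : p = 0
    · simp [hp]
    · exact (hpos p hp).le
  refine ⟨μ, hint, fun hfin => ?_, hμ⟩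
  -- On a finite support this nodal polynomial would vanish almost everywhere, contradicting `L(p²)
  -- > 0`.
  set p : ℝ[X] := ∏ a ∈ hfin.toFinset, (X - C a) with hp
  refine (hpos p (monic_prod_X_sub_C _ _).ne_zero).ne' ?_
  rw [← hμ]
  refine integral_eq_zero_of_ae ?_
  filter_upwards [Measure.support_mem_ae (μ := μ)] with x hx
  have h0 : p.eval x = 0 := by
    rw [hp, eval_prod]
    exact Finset.prod_eq_zero (hfin.mem_toFinset.2 hx) (by simp)
  simp [h0]

/-! ### Moment matrices of measures -/

/-- The Hankel matrix of moments of a measure. -/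
noncomputable def momentMatrix (μ : Measure ℝ) : InfMatrix := fun i j => ∫ x, x ^ (i + j) ∂μ

theorem isHankel_momentMatrix (μ : Measure ℝ) : IsHankel (momentMatrix μ) := fun i j => by
  simp only [momentMatrix, Nat.add_right_comm, Nat.add_assoc]

theorem momentFunctional_momentMatrix {μ : Measure ℝ}
    (hint : ∀ p : ℝ[X], Integrable (fun x => p.eval x) μ) (p : ℝ[X]) :
    momentFunctional (momentMatrix μ) p = ∫ x, p.eval x ∂μ := by
  induction p using Polynomial.induction_on' with
  | add p q hp hq =>
    simp only [eval_add]
    rw [map_add, hp, hq, integral_add (hint p) (hint q)]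
  | monomial n a =>
    rw [← C_mul_X_pow_eq_monomial, ← smul_eq_C_mul, map_smul, momentFunctional_X_pow]
    simp [momentMatrix, integral_const_mul]

theorem positiveBelow_momentMatrix {μ : Measure ℝ}
    (hint : ∀ p : ℝ[X], Integrable (fun x => p.eval x) μ) {n : ℕ}
    (hn : μ.support.Infinite ∨ n ≤ μ.support.ncard) :
    PositiveBelow (momentFunctional (momentMatrix μ)) n := by
  intro p hp hp0
  rw [momentFunctional_momentMatrix hint]
  refine lt_of_le_of_ne (integral_nonneg fun x => ?_) fun h => ?_
  · simpa using mul_self_nonneg (p.eval x)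
  · obtain ⟨hfin, hcard⟩ := finite_support_of_integral_mul_self hp0 (hint _) h.symm
    rcases hn with hn | hn
    · exact hn hfin
    · exact absurd hp (not_lt.2 ((Nat.cast_le.2 hn).trans hcard))

theorem posDefInfinite_momentMatrix {μ : Measure ℝ}
    (hint : ∀ p : ℝ[X], Integrable (fun x => p.eval x) μ) (hμ : μ.support.Infinite) :
    PosDefInfinite (momentMatrix μ) := fun _ _ =>
  (isHankel_momentMatrix μ).det_pos (positiveBelow_momentMatrix hint (Or.inl hμ))

/-- Positivity holds up to the number of support points; beyond that, the nodal polynomial of the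
support is a kernel vector. The zero measure gives order `0`. -/
theorem posDefOfOrder_momentMatrix {μ : Measure ℝ}
    (hint : ∀ p : ℝ[X], Integrable (fun x => p.eval x) μ) (hμ : μ.support.Finite) :
    PosDefOfOrder (momentMatrix μ) μ.support.ncard := by
  refine ⟨fun n _ hn => (isHankel_momentMatrix μ).det_pos
    (positiveBelow_momentMatrix hint (Or.inr hn)), fun n hn => ?_⟩
  rw [(isHankel_momentMatrix μ).det_eq_zero_iff]
  set p : ℝ[X] := ∏ a ∈ hμ.toFinset, (X - C a) with hp
  refine ⟨p, (monic_prod_X_sub_C _ _).ne_zero, ?_, fun q _ => ?_⟩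
  · rw [hp, degree_prod]
    simpa [← Set.ncard_eq_toFinset_card _ hμ] using hn
  · rw [momentFunctional_momentMatrix hint]
    refine integral_eq_zero_of_ae ?_
    filter_upwards [Measure.support_mem_ae (μ := μ)] with x hx
    have h0 : p.eval x = 0 := by
      rw [hp, eval_prod]
      exact Finset.prod_eq_zero (hμ.mem_toFinset.2 hx) (by simp)
    simp [h0]

/-! ### Entries of shifted and scaled matrices -/

theorem matPow_shift (k i j : ℕ) : matPow shift k i j = if i + k = j then 1 else 0 := by
  induction k generalizing i with
  | zero => simp [matPow, Matrix.one_apply]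
  | succ k ih =>
    change ∑ᶠ l, shift i l * matPow shift k l j = _
    rw [finsum_eq_single _ (i + 1) fun l hl => by simp [shift, hl.symm], ih]
    simp [shift, add_assoc, add_comm 1 k]

theorem matPow_shift_transpose (k i j : ℕ) :
    matPow shift.transpose k i j = if j + k = i then 1 else 0 := by
  induction k generalizing i with
  | zero => simp [matPow, Matrix.one_apply, eq_comm]
  | succ k ih =>
    change ∑ᶠ l, shift l i * matPow shift.transpose k l j = _
    rcases i with _ | i
    · rw [finsum_eq_zero_of_forall_eq_zero fun l => by simp [shift]]
      simp
    · rw [finsum_eq_single _ i fun l hl => by simp [shift, hl], ih]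
      simp [shift, ← add_assoc]

theorem matPow_shift_matMul (k : ℕ) (A : InfMatrix) (i j : ℕ) :
    matMul (matPow shift k) A i j = A (i + k) j := by
  change ∑ᶠ l, matPow shift k i l * A l j = _
  rw [finsum_eq_single _ (i + k) fun l hl => by simp [matPow_shift, hl.symm]]
  simp [matPow_shift]

theorem matMul_matPow_shift_transpose (k : ℕ) (A : InfMatrix) (i j : ℕ) :
    matMul A (matPow shift.transpose k) i j = A i (j + k) := by
  change ∑ᶠ l, A i l * matPow shift.transpose k l j = _
  rw [finsum_eq_single _ (j + k) fun l hl => by simp [matPow_shift_transpose, hl.symm]]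
  simp [matPow_shift_transpose]

theorem matPow_shift_transpose_matMul (k : ℕ) (A : InfMatrix) (i j : ℕ) :
    matMul (matPow shift.transpose k) A i j = if k ≤ i then A (i - k) j else 0 := by
  change ∑ᶠ l, matPow shift.transpose k i l * A l j = _
  split_ifs with h
  · rw [finsum_eq_single _ (i - k) fun l hl => ?_]
    · simp [matPow_shift_transpose, h]
    · rw [matPow_shift_transpose, if_neg (by omega), zero_mul]
  · exact finsum_eq_zero_of_forall_eq_zero fun l => by
      rw [matPow_shift_transpose, if_neg (by omega), zero_mul]

theorem diagD_matMul (k : ℕ) (A : InfMatrix) (i j : ℕ) :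
    matMul (diagD k) A i j = (k + i).descFactorial k * A i j := by
  change ∑ᶠ l, diagD k i l * A l j = _
  rw [finsum_eq_single _ i fun l hl => by simp [diagD, Matrix.diagonal_apply_ne' _ hl]]
  have h := Nat.factorial_mul_descFactorial (Nat.le_add_right k i)
  rw [Nat.add_sub_cancel_left] at h
  rw [diagD, Matrix.diagonal_apply_eq, ← h]
  push_cast
  rw [mul_div_cancel_left₀ _ (by exact_mod_cast i.factorial_ne_zero)]

/-- For `i < k` or `j < k` a falling factorial is zero, so the truncated subtractions on the right
are harmless. -/
theorem block_apply (k : ℕ) (H : InfMatrix) (i j : ℕ) :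
    block k H i j = i.descFactorial k * j.descFactorial k * H (i - k) (j - k) := by
  rw [block, matPow_shift_transpose_matMul]
  split_ifs with hi
  · rw [diagD_matMul, Nat.add_sub_cancel' hi]
    change _ * ∑ᶠ l, H (i - k) l * matMul (diagD k) (matPow shift k) l j = _
    simp only [diagD_matMul, matPow_shift]
    by_cases hj : k ≤ j
    · rw [finsum_eq_single _ (j - k) fun l hl => by rw [if_neg (by omega)]; simp]
      rw [Nat.add_sub_cancel' hj, if_pos (by omega)]
      ring
    · rw [finsum_eq_zero_of_forall_eq_zero fun l => by rw [if_neg (by omega)]; simp,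
        Nat.descFactorial_eq_zero_iff_lt.2 (not_le.1 hj)]
      simp
  · rw [Nat.descFactorial_eq_zero_iff_lt.2 (not_le.1 hi)]
    simp

theorem Phi_apply (A : InfMatrix) (η i j : ℕ) : Phi A η i j =
    ∑ l ∈ Finset.range (η + 1), (-1) ^ l * (η.choose l : ℝ) * A (i + (η - l)) (j + l) := by
  rw [Phi, Matrix.sum_apply]
  refine Finset.sum_congr rfl fun l _ => ?_
  rw [Matrix.smul_apply, smul_eq_mul]
  rw [matPow_shift_matMul, matMul_matPow_shift_transpose]

theorem topHankel_sum {ι : Type*} (s : Finset ι) (A : ι → InfMatrix) (d : ℕ) :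
    topHankel (∑ a ∈ s, A a) d = ∑ a ∈ s, topHankel (A a) d := by
  ext i j
  simp only [topHankel, Matrix.smul_apply, Matrix.sum_apply, Phi_apply, smul_eq_mul,
    Finset.mul_sum]
  exact Finset.sum_comm

/-! ### Finite differences and recovery of the Hankel components -/

theorem Polynomial.sum_alternating_choose_eval (P : ℝ[X]) (n : ℕ) :
    ∑ l ∈ Finset.range (2 * n + 1), (-1) ^ l * ((2 * n).choose l : ℝ) * P.eval (l : ℝ) =
      (fwdDiff 1)^[2 * n] (fun x => P.eval x) 0 := by
  rw [fwdDiff_iter_eq_sum_shift]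
  refine Finset.sum_congr rfl fun l hl => ?_
  have hl : l ≤ 2 * n := Nat.lt_succ_iff.1 (Finset.mem_range.1 hl)
  have hs : (-1 : ℤ) ^ (2 * n - l) = (-1) ^ l := by
    have h1 : (-1 : ℤ) ^ (2 * n - l) * (-1) ^ l = 1 := by
      rw [← pow_add, Nat.sub_add_cancel hl, pow_mul]; simp
    have h2 : (-1 : ℤ) ^ l * (-1) ^ l = 1 := by rw [← pow_add, ← two_mul, pow_mul]; simp
    exact mul_right_cancel₀ (pow_ne_zero l (by norm_num)) (h1.trans h2.symm)
  rw [hs, zsmul_eq_mul, nsmul_one, zero_add]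
  push_cast
  ring

/-- The alternating sum in `Φ(U⁻ᵏ D_k H D_k Uᵏ, 2d)`. -/
theorem sum_alternating_descFactorial {k d : ℕ} (hk : k ≤ d) (i j : ℕ) :
    ∑ l ∈ Finset.range (2 * d + 1), (-1) ^ l * ((2 * d).choose l : ℝ) *
      ((i + (2 * d - l)).descFactorial k * (j + l).descFactorial k) =
      if k = d then (-1) ^ d * ((2 * d).factorial : ℝ) else 0 := by
  -- As functions of `l`, the two falling factorials are polynomials of degree `k` with leading
  -- coefficients `(-1)^k` and `1`. The sum is the difference of order `2d` of a polynomial of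
  -- degree `2k`.
  set A : ℝ[X] := (descPochhammer ℝ k).comp (-X + C (i + 2 * d : ℝ)) with hA
  set B : ℝ[X] := (descPochhammer ℝ k).comp (X + C (j : ℝ)) with hB
  have hm : (descPochhammer ℝ k).Monic := monic_descPochhammer ℝ k
  have hn1 : (-X + C (i + 2 * d : ℝ)).natDegree = 1 := by
    rw [natDegree_add_C, natDegree_neg, natDegree_X]
  have hn2 : (X + C (j : ℝ)).natDegree = 1 := natDegree_X_add_C _
  have hl1 : (-X + C (i + 2 * d : ℝ)).leadingCoeff = -1 := by
    rw [leadingCoeff, hn1]; simp [coeff_X]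
  have hAl : A.leadingCoeff = (-1) ^ k := by
    rw [hA, leadingCoeff_comp (by rw [hn1]; exact one_ne_zero), hm.leadingCoeff, hl1,
      descPochhammer_natDegree, one_mul]
  have hBl : B.leadingCoeff = 1 := by
    rw [hB, leadingCoeff_comp (by rw [hn2]; exact one_ne_zero), hm.leadingCoeff,
      leadingCoeff_X_add_C, one_pow, one_mul]
  have hAn : A.natDegree = k := by
    rw [hA, natDegree_comp, hn1, descPochhammer_natDegree, mul_one]
  have hBn : B.natDegree = k := by
    rw [hB, natDegree_comp, hn2, descPochhammer_natDegree, mul_one]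
  have hAB : (A * B).natDegree = 2 * k := by
    have hA0 : A ≠ 0 := by
      rw [← leadingCoeff_ne_zero, hAl]; exact pow_ne_zero _ (by norm_num)
    have hB0 : B ≠ 0 := by rw [← leadingCoeff_ne_zero, hBl]; exact one_ne_zero
    rw [natDegree_mul hA0 hB0, hAn, hBn, two_mul]
  have hsum : ∑ l ∈ Finset.range (2 * d + 1), (-1) ^ l * ((2 * d).choose l : ℝ) *
      ((i + (2 * d - l)).descFactorial k * (j + l).descFactorial k) =
      (fwdDiff 1)^[2 * d] (fun x => (A * B).eval x) 0 := by
    rw [← sum_alternating_choose_eval]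
    refine Finset.sum_congr rfl fun l hl => ?_
    have hl : l ≤ 2 * d := Nat.lt_succ_iff.1 (Finset.mem_range.1 hl)
    rw [eval_mul, hA, hB, eval_comp, eval_comp, ← descPochhammer_eval_eq_descFactorial ℝ,
      ← descPochhammer_eval_eq_descFactorial ℝ]
    congr 3
    · simp [Nat.cast_sub hl]; ring
    · simp [add_comm]
  rw [hsum]
  split_ifs with hkd
  · subst hkd
    have := congrFun (fwdDiff_iter_degree_eq_factorial (A * B)) 0
    rw [hAB] at this
    rw [this, Pi.smul_apply, leadingCoeff_mul, hAl, hBl]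
    simp
  · rw [fwdDiff_iter_eq_zero_of_degree_lt (by rw [hAB]; omega), Pi.zero_apply]

/-- All entries in the alternating sum lie on one antidiagonal, so the Hankel factor comes out as a
constant; where its indices would be out of range, the falling factorials vanish. -/
theorem topHankel_block {k d : ℕ} (hk : k ≤ d) {H : InfMatrix} (hH : IsHankel H) :
    topHankel (block k H) d = if k = d then H else 0 := by
  ext i j
  have h : ∀ l ∈ Finset.range (2 * d + 1), (-1) ^ l * ((2 * d).choose l : ℝ) *
      block k H (i + (2 * d - l)) (j + l) = (-1) ^ l * ((2 * d).choose l : ℝ) *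
      ((i + (2 * d - l)).descFactorial k * (j + l).descFactorial k) *
        H 0 (i + j + 2 * d - 2 * k) := by
    intro l hl
    have hl : l ≤ 2 * d := Nat.lt_succ_iff.1 (Finset.mem_range.1 hl)
    rw [block_apply, mul_assoc ((-1 : ℝ) ^ l * _)]
    by_cases h1 : k ≤ i + (2 * d - l)
    · by_cases h2 : k ≤ j + l
      · rw [hH.eq_zero_add]
        congr 3
        omega
      · rw [Nat.descFactorial_eq_zero_iff_lt.2 (not_le.1 h2)]; simp
    · rw [Nat.descFactorial_eq_zero_iff_lt.2 (not_le.1 h1)]; simp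
  rw [topHankel, Matrix.smul_apply, Phi_apply, Finset.sum_congr rfl h, ← Finset.sum_mul,
    sum_alternating_descFactorial hk]
  split_ifs with hkd
  · subst hkd
    have hf : ((2 * k).factorial : ℝ) ≠ 0 := by exact_mod_cast (2 * k).factorial_ne_zero
    have hs : ((-1 : ℝ) ^ k) * (-1) ^ k = 1 := by rw [← mul_pow]; simp
    rw [hH.eq_zero_add i j, Nat.add_sub_cancel, smul_eq_mul]
    field_simp
    linear_combination (H 0 (i + j)) * hs
  · simp

/-- The matrices `H_{d-k}` recover the terms of a Hankel–Sobolev decomposition. -/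
theorem hankelComponent_eq {M : InfMatrix} {d : ℕ} {H : ℕ → InfMatrix}
    (hH : ∀ k, IsHankel (H k)) (hM : M = ∑ k ∈ Finset.range (d + 1), block k (H k)) {k : ℕ}
    (hk : k ≤ d) : hankelComponent M d k = H (d - k) := by
  have htop : ∀ n, topHankel (∑ l ∈ Finset.range (n + 1), block l (H l)) n = H n := by
    intro n
    rw [topHankel_sum, Finset.sum_range_succ, Finset.sum_eq_zero, zero_add,
      topHankel_block le_rfl (hH n), if_pos rfl]
    intro l hl
    have hl := Finset.mem_range.1 hl
    rw [topHankel_block hl.le (hH l), if_neg hl.ne]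
  -- After `k` steps exactly the blocks of index at most `d - k` remain, and `htop` reads off the
  -- top one.
  have hp : ∀ k, k ≤ d →
      partialMatrix M d k = ∑ l ∈ Finset.range (d - k + 1), block l (H l) := by
    intro k
    induction k with
    | zero => exact fun _ => hM
    | succ k ih =>
      intro hk
      rw [partialMatrix, ih (by omega), htop, Finset.sum_range_succ, add_sub_cancel_right]
      congr 2
      omega
  rw [hankelComponent, hp k hk, htop]

theorem eq_sum_block {M : InfMatrix} {d : ℕ} {H : ℕ → InfMatrix}
    (hM : ∀ i j, M i j = ∑ᶠ k, block k (H k) i j) (hd : ∀ k, d < k → H k = 0) :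
    M = ∑ k ∈ Finset.range (d + 1), block k (H k) := by
  ext i j
  rw [hM, Matrix.sum_apply]
  refine finsum_eq_sum_of_support_subset _ fun k hk => ?_
  by_contra h
  refine hk ?_
  simp only [Finset.coe_range, Set.mem_Iio] at h
  simp [block_apply, hd k (by omega)]

/-! ### Bilinear forms and their moment matrices -/

/-- The bilinear form on polynomials with a given matrix of moments. -/
noncomputable def matrixForm (M : InfMatrix) : LinearMap.BilinForm ℝ ℝ[X] :=
  LinearMap.mk₂ ℝ (fun p q => p.sum fun i a => q.sum fun j b => a * M i j * b)
    (fun p p' q => by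
      refine sum_add_index p p' _ (fun i => by simp [Polynomial.sum]) fun i a b => ?_
      simp [Polynomial.sum, add_mul, Finset.sum_add_distrib])
    (fun c p q => by
      rw [sum_smul_index p c _ fun i => by simp [Polynomial.sum]]
      simp [Polynomial.sum, Finset.mul_sum, mul_assoc])
    (fun p q q' => by
      rw [Polynomial.sum, Polynomial.sum, Polynomial.sum, ← Finset.sum_add_distrib]
      refine Finset.sum_congr rfl fun i _ => ?_
      exact sum_add_index q q' _ (fun i => by simp) fun i a b => mul_add _ _ _)
    (fun c p q => by
      rw [Polynomial.sum, Polynomial.sum, smul_eq_mul, Finset.mul_sum]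
      refine Finset.sum_congr rfl fun i _ => ?_
      rw [sum_smul_index q c _ fun i => by simp]
      simp [Polynomial.sum, Finset.mul_sum, mul_left_comm])

theorem matrixForm_formalMoments (G : InfMatrix) (t₀ : ℝ) (p q : ℝ[X]) :
    matrixForm (formalMoments G t₀) p q = formG G t₀ p q := rfl

theorem matrixForm_X_pow (M : InfMatrix) (i j : ℕ) :
    matrixForm M (X ^ i) (X ^ j) = M i j := by
  change (X ^ i : ℝ[X]).sum (fun i a => (X ^ j : ℝ[X]).sum fun j b => a * M i j * b) = _
  rw [← monomial_one_right_eq_X_pow, ← monomial_one_right_eq_X_pow,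
    sum_monomial_index _ _ (by simp [Polynomial.sum]), sum_monomial_index _ _ (by simp)]
  simp

theorem matrixForm_eq_sum (M : InfMatrix) {p q : ℝ[X]} {n : ℕ} (hp : p.natDegree < n)
    (hq : q.natDegree < n) : matrixForm M p q = ∑ i ∈ Finset.range n, ∑ j ∈ Finset.range n,
      p.coeff i * M i j * q.coeff j := by
  change p.sum (fun i a => q.sum fun j b => a * M i j * b) = _
  rw [sum_over_range' p (fun i => by simp [Polynomial.sum]) n hp]
  refine Finset.sum_congr rfl fun i _ => ?_
  rw [sum_over_range' q (fun j => by simp) n hq]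

theorem ext_bilinForm_X_pow {B B' : LinearMap.BilinForm ℝ ℝ[X]}
    (h : ∀ i j : ℕ, B (X ^ i) (X ^ j) = B' (X ^ i) (X ^ j)) : B = B' :=
  LinearMap.BilinForm.ext_basis (basisMonomials ℝ) fun i j => by
    simpa [monomial_one_right_eq_X_pow] using h i j

theorem integrable_eval_mul {μ : Measure ℝ}
    (hint : ∀ p : ℝ[X], Integrable (fun x => p.eval x) μ) (p q : ℝ[X]) :
    Integrable (fun x => p.eval x * q.eval x) μ := by
  simpa using hint (p * q)

/-- The Sobolev form as a bilinear form. -/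
noncomputable def sobolevBilinForm {d : ℕ} (μ : Fin (d + 1) → Measure ℝ)
    (hint : ∀ k, ∀ p : ℝ[X], Integrable (fun x => p.eval x) (μ k)) :
    LinearMap.BilinForm ℝ ℝ[X] :=
  LinearMap.mk₂ ℝ (sobolevForm μ)
    (fun p p' q => by
      rw [sobolevForm, sobolevForm, sobolevForm, ← Finset.sum_add_distrib]
      refine Finset.sum_congr rfl fun k _ => ?_
      rw [← integral_add (integrable_eval_mul (hint k) _ _) (integrable_eval_mul (hint k) _ _)]
      simp only [iterate_map_add, eval_add, add_mul])
    (fun c p q => by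
      rw [sobolevForm, sobolevForm, smul_eq_mul, Finset.mul_sum]
      refine Finset.sum_congr rfl fun k _ => ?_
      rw [← integral_const_mul]
      simp only [iterate_derivative_smul, eval_smul, smul_eq_mul, mul_assoc])
    (fun p q q' => by
      rw [sobolevForm, sobolevForm, sobolevForm, ← Finset.sum_add_distrib]
      refine Finset.sum_congr rfl fun k _ => ?_
      rw [← integral_add (integrable_eval_mul (hint k) _ _) (integrable_eval_mul (hint k) _ _)]
      simp only [iterate_map_add, eval_add, mul_add])
    (fun c p q => by
      rw [sobolevForm, sobolevForm, smul_eq_mul, Finset.mul_sum]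
      refine Finset.sum_congr rfl fun k _ => ?_
      rw [← integral_const_mul]
      simp only [iterate_derivative_smul, eval_smul, smul_eq_mul, mul_left_comm])

/-- This is where the block structure originates: differentiating `x^i` and `x^j` `k` times produces
the two falling factorials and the moment of order `i + j - 2k`. -/
theorem sobolevForm_X_pow {d : ℕ} (μ : Fin (d + 1) → Measure ℝ) (i j : ℕ) :
    sobolevForm μ (X ^ i) (X ^ j) = ∑ k : Fin (d + 1), block k (momentMatrix (μ k)) i j := by
  refine Finset.sum_congr rfl fun k _ => ?_
  rw [block_apply, momentMatrix, ← integral_const_mul]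
  simp only [iterate_derivative_X_pow_eq_smul, eval_smul, eval_pow, eval_X, pow_add, smul_eq_mul]
  refine integral_congr_ae (Filter.Eventually.of_forall fun x => ?_)
  simp only
  ring

theorem sobolevForm_eq_matrixForm_iff {d : ℕ} {μ : Fin (d + 1) → Measure ℝ}
    (hint : ∀ k, ∀ p : ℝ[X], Integrable (fun x => p.eval x) (μ k)) (M : InfMatrix) :
    (∀ p q, sobolevForm μ p q = matrixForm M p q) ↔
      M = ∑ k : Fin (d + 1), block k (momentMatrix (μ k)) := by
  constructor
  · intro h
    ext i j
    rw [← matrixForm_X_pow M, ← h, sobolevForm_X_pow, Matrix.sum_apply]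
  · intro h
    have : sobolevBilinForm μ hint = matrixForm M := ext_bilinForm_X_pow fun i j => by
      rw [matrixForm_X_pow, h, Matrix.sum_apply]
      exact sobolevForm_X_pow μ i j
    exact fun p q => congrFun (congrArg DFunLike.coe (congrFun (congrArg DFunLike.coe this) p)) q

/-! ### Generated polynomials and orthonormality -/

theorem genPoly_degree {G : InfMatrix} (hG : IsNondegenerateHessenberg G) {t₀ : ℝ} (ht₀ : t₀ ≠ 0)
    (n : ℕ) : (genPoly G t₀ n).degree = n := by
  induction n using Nat.strong_induction_on with
  | _ n ih =>
    rcases n with _ | n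
    · rw [genPoly, degree_C ht₀]; rfl
    · have h1 : (X * genPoly G t₀ n).degree = ((n + 1 : ℕ) : WithBot ℕ) := by
        rw [mul_comm, degree_mul_X, ih n (Nat.lt_succ_self n)]; rfl
      rw [genPoly.eq_2, degree_C_mul (inv_ne_zero (hG.2 n)), degree_sub_eq_left_of_degree_lt, h1]
      rw [h1]
      refine (degree_sum_le _ _).trans_lt ?_
      rw [Finset.sup_lt_iff (WithBot.bot_lt_coe _)]
      intro k _
      rw [← smul_eq_C_mul]
      refine (degree_smul_le _ _).trans_lt ?_
      rw [ih k k.2]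
      exact_mod_cast k.2

/-- The generated polynomials, as a sequence of polynomials of increasing degrees. -/
noncomputable def genSequence {G : InfMatrix} (hG : IsNondegenerateHessenberg G) {t₀ : ℝ}
    (ht₀ : t₀ ≠ 0) : Polynomial.Sequence ℝ := ⟨genPoly G t₀, genPoly_degree hG ht₀⟩

/-- Entrywise form of `T (T⁻¹ T⁻ᵀ) Tᵀ = 1`. -/
theorem genPoly_orthonormal {G : InfMatrix} (hG : IsNondegenerateHessenberg G) {t₀ : ℝ}
    (ht₀ : t₀ ≠ 0) (m n : ℕ) :
    matrixForm (formalMoments G t₀) (genPoly G t₀ m) (genPoly G t₀ n) =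
      if m = n then 1 else 0 := by
  set T := coeffMatrix G t₀ with hTdef
  have hdeg := genPoly_degree hG ht₀
  have hnat : ∀ k, (genPoly G t₀ k).natDegree = k := fun k =>
    natDegree_eq_of_degree_eq_some (hdeg k)
  have hT : ∀ i j, i < j → T i j = 0 := fun i j hij =>
    coeff_eq_zero_of_natDegree_lt (by rwa [hnat])
  have hd : ∀ i, T i i ≠ 0 := fun i => by
    have h : T i i = (genPoly G t₀ i).leadingCoeff := by rw [leadingCoeff, hnat]; rfl
    rw [h, leadingCoeff_ne_zero]
    exact fun h0 => by simpa [h0] using hdeg i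
  -- By triangularity, all sums for the rows `m` and `n` can be cut off at `N`, which makes the
  -- rearrangement finite.
  set N := max m n + 1 with hN
  have hinv : ∀ i k, i < N → ∑ l ∈ Finset.range N, T i l * lowerInv T l k =
      if i = k then 1 else 0 := by
    intro i k hi
    rw [← Matrix.one_apply, ← matMul_lowerInv T hT hd]
    refine (finsum_eq_sum_of_support_subset _ fun l hl => ?_).symm
    by_contra h
    simp only [Finset.coe_range, Set.mem_Iio, not_lt] at h
    exact hl (by simp [hT i l (by omega)])
  have hM : ∀ i j, i < N → formalMoments G t₀ i j =
      ∑ k ∈ Finset.range N, lowerInv T i k * lowerInv T j k := by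
    intro i j hi
    refine finsum_eq_sum_of_support_subset _ fun k hk => ?_
    by_contra h
    simp only [Finset.coe_range, Set.mem_Iio, not_lt] at h
    refine hk ?_
    change lowerInv T i k * _ = 0
    rw [lowerInv_eq_zero T i k (by omega), zero_mul]
  have hmN : m < N := by omega
  have hnN : n < N := by omega
  rw [matrixForm_eq_sum _ (n := N) (by rwa [hnat]) (by rwa [hnat])]
  calc _ = ∑ i ∈ Finset.range N, ∑ j ∈ Finset.range N, ∑ k ∈ Finset.range N,
        (T m i * lowerInv T i k) * (T n j * lowerInv T j k) := by
        refine Finset.sum_congr rfl fun i hi => Finset.sum_congr rfl fun j _ => ?_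
        rw [hM i j (Finset.mem_range.1 hi), Finset.mul_sum, Finset.sum_mul]
        refine Finset.sum_congr rfl fun k _ => ?_
        simp only [hTdef, coeffMatrix]
        ring
    _ = ∑ k ∈ Finset.range N, (∑ i ∈ Finset.range N, T m i * lowerInv T i k) *
        (∑ j ∈ Finset.range N, T n j * lowerInv T j k) := by
        simp only [Finset.sum_mul_sum]
        conv_rhs => rw [Finset.sum_comm]
        exact Finset.sum_congr rfl fun i _ => Finset.sum_comm
    _ = if m = n then 1 else 0 := by
        rw [Finset.sum_congr rfl fun k _ => by rw [hinv m k hmN, hinv n k hnN]]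
        simp only [ite_mul, one_mul, zero_mul, Finset.sum_ite_eq, Finset.mem_range, if_pos hmN,
          eq_comm (a := n)]

/-- The generated polynomials have one member in each degree, hence form a basis, on which the form
of `G` has the identity as its Gram matrix. -/
theorem sobolevForm_eq_iff_orthonormal {G : InfMatrix} (hG : IsNondegenerateHessenberg G) {t₀ : ℝ}
    (ht₀ : t₀ ≠ 0) {d : ℕ} {μ : Fin (d + 1) → Measure ℝ}
    (hint : ∀ k, ∀ p : ℝ[X], Integrable (fun x => p.eval x) (μ k)) :
    (∀ p q : ℝ[X], sobolevForm μ p q = formG G t₀ p q) ↔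
      ∀ m n : ℕ, sobolevForm μ (genPoly G t₀ m) (genPoly G t₀ n) = if m = n then 1 else 0 := by
  constructor
  · intro h m n
    rw [h, ← matrixForm_formalMoments, genPoly_orthonormal hG ht₀]
  · intro h p q
    have hc : ∀ i, IsUnit (genSequence hG ht₀ i).leadingCoeff := fun i =>
      (leadingCoeff_ne_zero.2 (Polynomial.Sequence.ne_zero _ i)).isUnit
    have : sobolevBilinForm μ hint = matrixForm (formalMoments G t₀) := by
      refine LinearMap.BilinForm.ext_basis ((genSequence hG ht₀).basis hc) fun i j => ?_
      rw [Polynomial.Sequence.basis_eq_self, Polynomial.Sequence.basis_eq_self]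
      exact (h i j).trans (genPoly_orthonormal hG ht₀ i j).symm
    exact congrFun (congrArg DFunLike.coe (congrFun (congrArg DFunLike.coe this) p)) q

/-! ### The Favard type theorem -/

theorem momentMatrix_ne_zero {μ : Measure ℝ}
    (hint : ∀ p : ℝ[X], Integrable (fun x => p.eval x) μ) (hμ : μ.support.Infinite) :
    momentMatrix μ ≠ 0 := by
  intro h
  have := posDefInfinite_momentMatrix hint hμ 1 le_rfl
  rw [h] at this
  simp [leading] at this

/-- Uniqueness of the decomposition identifies the computed components with those of any given
decomposition, so the measures can be handled independently for each index. -/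
theorem exists_measures_iff {G : InfMatrix} (hG : IsNondegenerateHessenberg G) (t₀ : ℝ) (d : ℕ) :
    (∃ μ : Fin (d + 1) → Measure ℝ, IsDiscreteContinuous μ ∧
        ∀ p q : ℝ[X], sobolevForm μ p q = formG G t₀ p q) ↔
      (IsHessenbergSobolevOfIndex G t₀ d ∧
        PosDefInfinite (hankelComponent (formalMoments G t₀) d 0) ∧
        ∀ k : ℕ, 1 ≤ k → k ≤ d →
          ∃ m : ℕ, PosDefOfOrder (hankelComponent (formalMoments G t₀) d k) m) := by
  constructor
  · rintro ⟨μ, ⟨-, hint, hinf, hfin⟩, h⟩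
    have hM := (sobolevForm_eq_matrixForm_iff hint (formalMoments G t₀)).1 h
    let H : ℕ → InfMatrix := fun k => if hk : k < d + 1 then momentMatrix (μ ⟨k, hk⟩) else 0
    have hH : ∀ k, IsHankel (H k) := by
      intro k
      by_cases hk : k < d + 1
      · simp only [H, dif_pos hk]; exact isHankel_momentMatrix _
      · simp only [H, dif_neg hk]; exact fun _ _ => rfl
    have hHval : ∀ k : Fin (d + 1), H k = momentMatrix (μ k) := fun k => dif_pos k.2
    have hH0 : ∀ k, d < k → H k = 0 := fun k hk => dif_neg (by omega)
    have hMH : formalMoments G t₀ = ∑ k ∈ Finset.range (d + 1), block k (H k) := by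
      rw [hM, Finset.sum_range]
      exact Finset.sum_congr rfl fun k _ => by rw [hHval]
    have hHd : H d = momentMatrix (μ (Fin.last d)) := hHval (Fin.last d)
    refine ⟨⟨hG, H, hH, fun i j => ?_, ?_, hH0⟩, ?_, fun k h1 hk => ?_⟩
    · rw [hMH, Matrix.sum_apply]
      refine (finsum_eq_sum_of_support_subset _ fun k hk => ?_).symm
      by_contra h'
      refine hk ?_
      simp only [Finset.coe_range, Set.mem_Iio] at h'
      simp [block_apply, hH0 k (by omega)]
    · rw [hHd]
      exact momentMatrix_ne_zero (hint _) hinf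
    · rw [hankelComponent_eq hH hMH (Nat.zero_le d), Nat.sub_zero, hHd]
      exact posDefInfinite_momentMatrix (hint _) hinf
    · rw [hankelComponent_eq hH hMH hk, hHval ⟨d - k, by omega⟩]
      exact ⟨_, posDefOfOrder_momentMatrix (hint _)
        (hfin ⟨d - k, by omega⟩ (Nat.sub_lt (by omega) h1))⟩
  · rintro ⟨⟨-, H, hH, hM, -, hH0⟩, hinf, hfin⟩
    have hMH := eq_sum_block hM hH0
    rw [hankelComponent_eq hH hMH (Nat.zero_le d), Nat.sub_zero] at hinf
    have hex : ∀ k : Fin (d + 1), ∃ μ : Measure ℝ,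
        (∀ p : ℝ[X], Integrable (fun x => p.eval x) μ) ∧
        (if (k : ℕ) < d then μ.support.Finite else μ.support.Infinite) ∧
        ∀ p : ℝ[X], ∫ x, p.eval x ∂μ = momentFunctional (H k) p := by
      intro k
      by_cases hk : (k : ℕ) < d
      -- Components are counted down from the top, so `H_k` is the component numbered `d - k`.
      · obtain ⟨m, hm⟩ := hfin (d - k) (by omega) (Nat.sub_le _ _)
        rw [hankelComponent_eq hH hMH (Nat.sub_le _ _), Nat.sub_sub_self hk.le] at hm
        simp only [if_pos hk]
        exact (hH k).exists_measure_of_posDefOfOrder hm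
      · have hkd : (k : ℕ) = d := by omega
        simp only [hkd, lt_irrefl, if_false]
        exact (hH d).exists_measure_of_posDefInfinite hinf
    choose μ hint hsupp hμ using hex
    have hmom : ∀ k, momentMatrix (μ k) = H k := by
      intro k
      ext i j
      rw [momentMatrix, (hH k).eq_zero_add, ← momentFunctional_X_pow (H k), ← hμ]
      simp
    refine ⟨μ, ⟨fun k => isFiniteMeasure_of_integrable_eval (hint k), hint, ?_, fun k hk => ?_⟩, ?_⟩
    · simpa using hsupp (Fin.last d)
    · simpa [hk] using hsupp k
    · refine (sobolevForm_eq_matrixForm_iff hint (formalMoments G t₀)).2 ?_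
      rw [hMH, Finset.sum_range]
      exact Finset.sum_congr rfl fun k _ => by rw [hmom]

theorem mainTheorem5 (G : InfMatrix) (hG : IsNondegenerateHessenberg G) (t₀ : ℝ) (ht₀ : 0 < t₀) :
    ((∃ (d : ℕ) (μ : Fin (d + 1) → MeasureTheory.Measure ℝ), IsDiscreteContinuous μ ∧
        ∀ p q : Polynomial ℝ, sobolevForm μ p q = formG G t₀ p q) ↔
      ∃ d : ℕ, IsHessenbergSobolevOfIndex G t₀ d ∧
        PosDefInfinite (hankelComponent (formalMoments G t₀) d 0) ∧
        ∀ k : ℕ, 1 ≤ k → k ≤ d →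
          ∃ m : ℕ, PosDefOfOrder (hankelComponent (formalMoments G t₀) d k) m) ∧
    (∀ d : ℕ,
      (∃ μ : Fin (d + 1) → MeasureTheory.Measure ℝ, IsDiscreteContinuous μ ∧
        ∀ p q : Polynomial ℝ, sobolevForm μ p q = formG G t₀ p q) ↔
      (IsHessenbergSobolevOfIndex G t₀ d ∧
        PosDefInfinite (hankelComponent (formalMoments G t₀) d 0) ∧
        ∀ k : ℕ, 1 ≤ k → k ≤ d →
          ∃ m : ℕ, PosDefOfOrder (hankelComponent (formalMoments G t₀) d k) m)) ∧
    (∀ (d : ℕ) (μ : Fin (d + 1) → MeasureTheory.Measure ℝ), IsDiscreteContinuous μ →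
      ((∀ p q : Polynomial ℝ, sobolevForm μ p q = formG G t₀ p q) ↔
        ∀ m n : ℕ, sobolevForm μ (genPoly G t₀ m) (genPoly G t₀ n) = if m = n then 1 else 0)) :=
  ⟨exists_congr fun d => exists_measures_iff hG t₀ d, fun d => exists_measures_iff hG t₀ d,
    fun _ _ hμ => sobolevForm_eq_iff_orthonormal hG ht₀.ne' hμ.2.1⟩
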